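/- Let $1<s<\infty$, $\theta=\frac1{s-1}\in(0,\infty)$, and let $a(y)=e^{-y^{-\theta}}$ for $y>0$, $a(y)=0$ for $y\le 0$. There are a real number $c(s)>0$ and a complex number $d(s)$, depending only on $s$, with $$\operatorname{Re} d(s)=-\cos\!\big(\pi(1-1/s)\big)\,\big(2(s-1)\big)^{-2(1-1/s)},$$ which is $<0$ for $s<2$, such that for every $c_0>0$ and uniformly for $c_0\le x\le\infty$, $$\int_{-x}^{x} e^{-y^2/h-2iy/h}\,a(y)\,dy\;\sim\; h^{1-\frac1{2s}}\exp\!\left(\frac{-c(s)+d(s)\,h^{1-1/s}+O\big(h^{2(1-1/s)}\big)}{h^{1/s}}\right)\qquad (h\to0^+).$$ Here $\sim$ denotes equality up to a (complex) factor whose modulus is bounded above and bounded away from $0$, uniformly in $x$ and $h$. That is, there are $h_0,K,C>0$ depending only on $s$ and $c_0$ such that for all $0<h\le h_0$ and $c_0\le x\le\infty$ the integral equals $q\,h^{1-\frac1{2s}}\exp\big((-c(s)+d(s)h^{1-1/s}+r)/h^{1/s}\big)$ for some $q,r\in\mathbb C$ (which may depend on $x$ and $h$) with $C^{-1}\le|q|\le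 C$ and $|r|\le K h^{2(1-1/s)}$. -/

import Mathlib

/-- The symbol `a(y) = exp (-y ^ (-θ))` for `y > 0`, and `a(y) = 0` for `y ≤ 0`. -/
noncomputable def flatSymbol (θ y : ℝ) : ℝ :=
  if 0 < y then Real.exp (-(y ^ (-θ))) else 0

/-- The oscillatory integral `∫_{-x}^{x} exp (-y²/h - 2iy/h) a(y) dy`, for an extended real
endpoint `x`; for `x = ⊤` it is the integral over the whole real line. -/
noncomputable def oscIntegral (θ h : ℝ) (x : EReal) : ℂ :=
  ∫ y : ℝ in {y : ℝ | -x ≤ (y : EReal) ∧ (y : EReal) ≤ x},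
    Complex.exp (-(y : ℂ) ^ 2 / (h : ℂ) - 2 * Complex.I * (y : ℂ) / (h : ℂ)) *
      (flatSymbol θ y : ℂ)

open Filter Topology MeasureTheory Set Asymptotics

/-! The integral is governed by a saddle at scale y ~ h^(1-1/s). Put ε = h^(1-1/s) and μ² =
h^(-1/s), so that h = ε/μ² and ε^(-θ) = μ². With y = ε t the exponent is μ²(-2it - t^(-θ) - ε t²):
the large parameter is μ², and the Gaussian is a perturbation of size ε.

In τ = log t the unperturbed phase has a saddle τ₀ at angle -π/(2(θ+1)). The inverse function
theorem moves it to an exact saddle τ(ε) of the perturbed phase. Since τ₀ is critical, the critical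
value is `logPhase θ τ₀` - ε e^(2τ₀) + O(ε²) (`isBigO_logPhase_sub`). Hence c = -Re `logPhase θ τ₀`
and d = -e^(2τ₀), the O(ε²) is r, and the imaginary part of the leading value is a phase absorbed in
q.

The contour for log y is shifted to the horizontal line through τ(ε), a ray in y. There the phase
differs from its critical value by exactly -(A W(z) + εB(e^z - 1)²), with W = `phaseWell θ`
(`logPhase_add`). Since Re B < 0 near the saddle when s > 2, the second term must be controlled: W
dominates it as long as y stays below a fixed small cutoff (`mul_exp_sub_one_sq_le`). Rescaling z =
v/μ then gives a nonzero Gaussian limit, and the prefactor h^(1-1/(2s)) = ε/μ.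

The cutoff and the side closing the contour cost exp(-const/h), negligible against exp(-O(h^(-1/s)))
because s > 1. The cutoff lies below c₀, whence the uniformity in x. -/

/-! ### Convexity of the phase along the ray -/

/-- The increment `θ e^z + e^{-θ z} - (θ + 1)` of the phase along the ray through its saddle point. -/
noncomputable def phaseWell (θ z : ℝ) : ℝ :=
  θ * (Real.exp z - 1 - z) + (Real.exp (-θ * z) - 1 + θ * z)

lemma mul_sq_le_phaseWell {θ : ℝ} (hθ : 0 < θ) (z : ℝ) :
    min θ (θ ^ 2) / 2 * z ^ 2 ≤ phaseWell θ z := by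
  have h1 : 0 ≤ Real.exp z - 1 - z := by linarith [Real.add_one_le_exp z]
  have h2 : 0 ≤ Real.exp (-θ * z) - 1 + θ * z := by linarith [Real.add_one_le_exp (-θ * z)]
  unfold phaseWell
  rcases le_total 0 z with hz | hz
  · have h3 := Real.quadratic_le_exp_of_nonneg hz
    have h4 : min θ (θ ^ 2) * z ^ 2 ≤ θ * z ^ 2 := by gcongr; exact min_le_left _ _
    have h5 : θ * (z ^ 2 / 2) ≤ θ * (Real.exp z - 1 - z) := by gcongr; linarith
    linarith
  · have h3 := Real.quadratic_le_exp_of_nonneg (x := -θ * z) (by nlinarith)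
    have h4 : min θ (θ ^ 2) * z ^ 2 ≤ θ ^ 2 * z ^ 2 := by gcongr; exact min_le_right _ _
    have h5 := mul_nonneg hθ.le h1
    nlinarith

lemma phaseWell_nonneg {θ : ℝ} (hθ : 0 < θ) (z : ℝ) : 0 ≤ phaseWell θ z :=
  le_trans (by positivity) (mul_sq_le_phaseWell hθ z)

/-- For large z both sides matter: (e^z - 1)² grows like the square of the well, and the condition ε
e^z ≤ ρ pays for one factor e^z. The constant is proportional to ρ, so a small cutoff makes the
perturbation a small fraction of the well. -/
lemma mul_exp_sub_one_sq_le {θ ε ρ z : ℝ} (hθ : 0 < θ) (hε : 0 ≤ ε) (hερ : ε ≤ ρ)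
    (hz : ε * Real.exp z ≤ ρ) :
    ε * (Real.exp z - 1) ^ 2 ≤ 2 / min θ (θ ^ 2) * ρ * phaseWell θ z := by
  have hm : 0 < min θ (θ ^ 2) := lt_min hθ (by positivity)
  have hρ : 0 ≤ ρ := hε.trans hερ
  have key : ε * (Real.exp z - 1) ^ 2 * min θ (θ ^ 2) ≤ 2 * ρ * phaseWell θ z := by
    rcases le_total 0 z with h0 | h0
    · have h1 : 0 ≤ Real.exp z - 1 - z := by linarith [Real.add_one_le_exp z]
      have h2 : 0 ≤ Real.exp (-θ * z) - 1 + θ * z := by linarith [Real.add_one_le_exp (-θ * z)]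
      -- The difference of the two sides is 2e^z (sinh z - z).
      have h3 : (Real.exp z - 1) ^ 2 ≤ 2 * Real.exp z * (Real.exp z - 1 - z) := by
        have h4 : z ≤ (Real.exp z - Real.exp (-z)) / 2 := by
          rw [← Real.sinh_eq]; exact Real.self_le_sinh_iff.2 h0
        have h5 : Real.exp z * Real.exp (-z) = 1 := by rw [← Real.exp_add]; simp
        have h6 := mul_le_mul_of_nonneg_left h4 (Real.exp_pos z).le
        nlinarith
      calc ε * (Real.exp z - 1) ^ 2 * min θ (θ ^ 2)
          ≤ ε * (2 * Real.exp z * (Real.exp z - 1 - z)) * θ := by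
            gcongr
            exact min_le_left _ _
        _ = 2 * (ε * Real.exp z) * (θ * (Real.exp z - 1 - z)) := by ring
        _ ≤ 2 * ρ * phaseWell θ z := by
            unfold phaseWell
            gcongr
            linarith
    · have h1 : (Real.exp z - 1) ^ 2 ≤ z ^ 2 := by
        have := Real.exp_le_one_iff.2 h0
        nlinarith [Real.add_one_le_exp z]
      have h2 := mul_sq_le_phaseWell hθ z
      calc ε * (Real.exp z - 1) ^ 2 * min θ (θ ^ 2)
          ≤ ρ * z ^ 2 * min θ (θ ^ 2) := by gcongr
        _ = 2 * ρ * (min θ (θ ^ 2) / 2 * z ^ 2) := by ring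
        _ ≤ _ := by gcongr
  rw [div_mul_eq_mul_div, div_mul_eq_mul_div, le_div_iff₀ hm]
  exact key

lemma tendsto_sq_mul_exp_div_sub {ι : Type*} {l : Filter ι} {μ : ι → ℝ} (hμ : Tendsto μ l atTop)
    (a : ℝ) :
    Tendsto (fun i => μ i ^ 2 * (Real.exp (a / μ i) - 1 - a / μ i)) l (𝓝 (a ^ 2 / 2)) := by
  have h0 : Tendsto (fun i => a / μ i) l (𝓝 0) := hμ.const_div_atTop a
  have h1 : Tendsto (fun i => a ^ 2 * |a / μ i|) l (𝓝 0) := by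
    simpa using (h0.abs.const_mul (a ^ 2))
  rw [tendsto_iff_norm_sub_tendsto_zero]
  refine squeeze_zero' (Eventually.of_forall fun _ => norm_nonneg _) ?_ h1
  filter_upwards [hμ.eventually_gt_atTop 0, h0.abs.eventually_le_const (u := 1) (by simp)] with i hi hi1
  have h3 := Real.exp_bound hi1 (n := 3) (by norm_num)
  have h4 : μ i * (a / μ i) = a := by field_simp
  set x := a / μ i with hx
  have h5 : Real.exp x - ∑ m ∈ Finset.range 3, x ^ m / (m.factorial : ℝ) =
      Real.exp x - 1 - x - x ^ 2 / 2 := by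
    simp [Finset.sum_range_succ, Nat.factorial]; ring
  rw [h5] at h3
  have h6 : μ i ^ 2 * (Real.exp x - 1 - x) - a ^ 2 / 2 =
      μ i ^ 2 * (Real.exp x - 1 - x - x ^ 2 / 2) := by
    rw [← h4]; ring
  rw [h6, Real.norm_eq_abs, abs_mul, abs_of_nonneg (sq_nonneg (μ i))]
  calc μ i ^ 2 * |Real.exp x - 1 - x - x ^ 2 / 2| ≤ μ i ^ 2 * |x| ^ 3 := by
        gcongr
        refine h3.trans (mul_le_of_le_one_right (by positivity) (by norm_num [Nat.factorial]))
    _ = (μ i * x) ^ 2 * |x| := by rw [mul_pow, ← sq_abs x]; ring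
    _ = a ^ 2 * |x| := by rw [h4]

lemma tendsto_sq_mul_phaseWell {ι : Type*} {l : Filter ι} {μ : ι → ℝ} (hμ : Tendsto μ l atTop)
    (θ v : ℝ) :
    Tendsto (fun i => μ i ^ 2 * phaseWell θ (v / μ i)) l (𝓝 (θ * (θ + 1) / 2 * v ^ 2)) := by
  have h1 := (tendsto_sq_mul_exp_div_sub hμ v).const_mul θ
  have h2 := tendsto_sq_mul_exp_div_sub hμ (-θ * v)
  convert h1.add h2 using 2
  · unfold phaseWell
    rw [mul_div_assoc (-θ) v]; ring
  · ring

lemma tendsto_sq_mul_exp_sub_one_sq {ι : Type*} {l : Filter ι} {μ : ι → ℝ}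
    (hμ : Tendsto μ l atTop) (v : ℝ) :
    Tendsto (fun i => μ i ^ 2 * (Real.exp (v / μ i) - 1) ^ 2) l (𝓝 (v ^ 2)) := by
  have h1 : Tendsto (fun i => μ i * (Real.exp (v / μ i) - 1)) l (𝓝 v) := by
    have h2 := (tendsto_sq_mul_exp_div_sub hμ v).mul hμ.inv_tendsto_atTop
    have h3 := h2.add_const v
    simp only [mul_zero, zero_add] at h3
    refine h3.congr' ?_
    filter_upwards [hμ.eventually_gt_atTop 0] with i hi
    simp only [Pi.inv_apply]
    field_simp
    ring
  simpa [mul_pow] using h1.pow 2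

/-! ### Laplace's method with moving coefficients -/

/-- The integrand of the Laplace integral along the ray through the saddle point. -/
noncomputable def laplaceIntegrand (θ ε μ : ℝ) (A B : ℂ) (z : ℝ) : ℂ :=
  Complex.exp z * Complex.exp (-((μ : ℂ) ^ 2 *
    (A * (phaseWell θ z : ℝ) + ε * B * ((Real.exp z - 1 : ℝ) : ℂ) ^ 2)))

lemma continuous_laplaceIntegrand (θ ε μ : ℝ) (A B : ℂ) :
    Continuous (laplaceIntegrand θ ε μ A B) := by
  unfold laplaceIntegrand phaseWell
  fun_prop

lemma norm_laplaceIntegrand_le {θ ε μ κ ρ z : ℝ} {A B : ℂ} (hθ : 0 < θ) (hε : 0 ≤ ε)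
    (hερ : ε ≤ ρ) (hz : ε * Real.exp z ≤ ρ)
    (hκ : 0 ≤ κ) (hAB : κ ≤ A.re - ‖B‖ * (2 / min θ (θ ^ 2) * ρ)) :
    ‖laplaceIntegrand θ ε μ A B z‖ ≤
      Real.exp z * Real.exp (-(κ * (min θ (θ ^ 2) / 2) * (μ * z) ^ 2)) := by
  have h1 := mul_exp_sub_one_sq_le hθ hε hερ hz
  have h2 := mul_sq_le_phaseWell hθ z
  have h3 := phaseWell_nonneg hθ z
  have hre : (-((μ : ℂ) ^ 2 *
      (A * (phaseWell θ z : ℝ) + ε * B * ((Real.exp z - 1 : ℝ) : ℂ) ^ 2))).re =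
      -(μ ^ 2 * (A.re * phaseWell θ z + ε * (Real.exp z - 1) ^ 2 * B.re)) := by
    rw [show (-((μ : ℂ) ^ 2 *
      (A * (phaseWell θ z : ℝ) + ε * B * ((Real.exp z - 1 : ℝ) : ℂ) ^ 2))) =
      ((-(μ ^ 2 * phaseWell θ z) : ℝ) : ℂ) * A +
      ((-(μ ^ 2 * (ε * (Real.exp z - 1) ^ 2)) : ℝ) : ℂ) * B by push_cast; ring]
    rw [Complex.add_re, Complex.re_ofReal_mul, Complex.re_ofReal_mul]
    ring
  unfold laplaceIntegrand
  rw [norm_mul, Complex.norm_exp, Complex.norm_exp, Complex.ofReal_re, hre]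
  refine mul_le_mul_of_nonneg_left (Real.exp_le_exp.2 (neg_le_neg ?_)) (Real.exp_pos _).le
  have hB : -‖B‖ ≤ B.re := (abs_le.1 (Complex.abs_re_le_norm B)).1
  have h4 : 0 ≤ ε * (Real.exp z - 1) ^ 2 := by positivity
  have h5 : κ * phaseWell θ z ≤ A.re * phaseWell θ z + ε * (Real.exp z - 1) ^ 2 * B.re := by
    have h6 := mul_le_mul_of_nonneg_left hB h4
    have h7 := mul_le_mul_of_nonneg_right hAB h3
    have h8 := mul_le_mul_of_nonneg_left h1 (norm_nonneg B)
    nlinarith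
  calc κ * (min θ (θ ^ 2) / 2) * (μ * z) ^ 2 = μ ^ 2 * (κ * (min θ (θ ^ 2) / 2 * z ^ 2)) := by ring
    _ ≤ μ ^ 2 * (κ * phaseWell θ z) := by gcongr
    _ ≤ _ := by gcongr

/-- Dominated convergence after v = μ z. The coefficients vary with the index because the saddle
does; κ keeps the Gaussian decay uniform. -/
theorem tendsto_mul_integral_laplaceIntegrand {ι : Type*} {l : Filter ι} [l.IsCountablyGenerated]
    {θ κ ρ : ℝ} (hθ : 0 < θ) (hκ : 0 < κ) {A B : ι → ℂ} {ε μ Z : ι → ℝ} {A₀ B₀ : ℂ}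
    (hA : Tendsto A l (𝓝 A₀)) (hB : Tendsto B l (𝓝 B₀)) (hε : Tendsto ε l (𝓝 0))
    (hμ : Tendsto μ l atTop) (hZ : Tendsto Z l atTop) (hε0 : ∀ᶠ i in l, 0 ≤ ε i)
    (hερ : ∀ᶠ i in l, ε i ≤ ρ) (hZρ : ∀ᶠ i in l, ε i * Real.exp (Z i) ≤ ρ)
    (hAB : ∀ᶠ i in l, κ ≤ (A i).re - ‖B i‖ * (2 / min θ (θ ^ 2) * ρ)) :
    Tendsto (fun i => (μ i : ℂ) * ∫ z in Iic (Z i), laplaceIntegrand θ (ε i) (μ i) (A i) (B i) z) l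
      (𝓝 (∫ v : ℝ, Complex.exp (-(A₀ * ((θ * (θ + 1) / 2 : ℝ) : ℂ)) * (v : ℂ) ^ 2))) := by
  have hm : 0 < min θ (θ ^ 2) := lt_min hθ (by positivity)
  set F : ι → ℝ → ℂ := fun i =>
    (Iic (Z i)).indicator (laplaceIntegrand θ (ε i) (μ i) (A i) (B i)) with hF
  have hscale : ∀ᶠ i in l, ∫ v : ℝ, F i (v / μ i) =
      (μ i : ℂ) * ∫ z in Iic (Z i), laplaceIntegrand θ (ε i) (μ i) (A i) (B i) z := by
    filter_upwards [hμ.eventually_gt_atTop 0] with i hi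
    rw [Measure.integral_comp_div, abs_of_pos hi, integral_indicator measurableSet_Iic,
      Complex.real_smul]
  refine Tendsto.congr' hscale ?_
  set b := κ * (min θ (θ ^ 2) / 2) with hb
  have hbpos : 0 < b := by positivity
  refine tendsto_integral_filter_of_dominated_convergence
    (fun v : ℝ => Real.exp |v| * Real.exp (-(b * v ^ 2))) ?_ ?_ ?_ ?_
  · refine Eventually.of_forall fun i => ?_
    have h1 : Measurable (F i) :=
      (continuous_laplaceIntegrand _ _ _ _ _).measurable.indicator measurableSet_Iic
    exact (h1.comp (measurable_id.div_const (μ i))).aestronglyMeasurable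
  · filter_upwards [hε0, hερ, hZρ, hAB, hμ.eventually_ge_atTop 1] with i h0 h1 h2 h3 h4
    refine Eventually.of_forall fun v => ?_
    rw [hF]
    by_cases hv : v / μ i ∈ Iic (Z i)
    · simp only [indicator_of_mem hv]
      have h5 : ε i * Real.exp (v / μ i) ≤ ρ := by
        refine le_trans ?_ h2
        gcongr
        exact hv
      refine (norm_laplaceIntegrand_le hθ h0 h1 h5 hκ.le h3).trans ?_
      have h6 : μ i * (v / μ i) = v := by
        have : μ i ≠ 0 := by linarith
        field_simp
      rw [h6]
      gcongr
      refine (le_abs_self _).trans ?_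
      rw [abs_div]
      exact div_le_self (abs_nonneg _) (h4.trans (le_abs_self _))
    · simp only [indicator_of_notMem hv, norm_zero]
      positivity
  -- The linear exponent |v| is absorbed into half of the Gaussian by completing the square.
  · have h1 : Integrable (fun v : ℝ => Real.exp (1 / b) * Real.exp (-(b / 2) * v ^ 2)) :=
      (integrable_exp_neg_mul_sq (by positivity)).const_mul _
    refine h1.mono' (by fun_prop) (Eventually.of_forall fun v => ?_)
    rw [Real.norm_of_nonneg (by positivity), ← Real.exp_add, ← Real.exp_add]
    refine Real.exp_le_exp.2 ?_
    have h2 : |v| ≤ 1 / b + b / 2 * v ^ 2 := by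
      have h3 : 0 ≤ b / 2 * (|v| - 1 / b) ^ 2 := by positivity
      have h4 : b / 2 * (|v| - 1 / b) ^ 2 = b / 2 * v ^ 2 - |v| + 1 / b / 2 := by
        rw [sub_sq, sq_abs]; field_simp
      have h5 : 0 < 1 / b := by positivity
      linarith
    linarith
  · refine Eventually.of_forall fun v => ?_
    have hcut : ∀ᶠ i in l, v / μ i ∈ Iic (Z i) := by
      filter_upwards [hZ.eventually_ge_atTop |v|, hμ.eventually_ge_atTop 1] with i h1 h2
      refine le_trans ((le_abs_self _).trans ?_) h1
      rw [abs_div]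
      exact div_le_self (abs_nonneg _) (h2.trans (le_abs_self _))
    have hlim : Tendsto (fun i => laplaceIntegrand θ (ε i) (μ i) (A i) (B i) (v / μ i)) l
        (𝓝 (Complex.exp (-(A₀ * ((θ * (θ + 1) / 2 : ℝ) : ℂ)) * (v : ℂ) ^ 2))) := by
      have h1 := (Complex.continuous_ofReal.tendsto _).comp (tendsto_sq_mul_phaseWell hμ θ v)
      have h2 := (Complex.continuous_ofReal.tendsto _).comp (tendsto_sq_mul_exp_sub_one_sq hμ v)
      have h3 := (Complex.continuous_ofReal.tendsto _).comp hε
      have h4 := ((hA.mul h1).add ((h3.mul hB).mul h2)).neg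
      have h5 := (Complex.continuous_exp.tendsto _).comp h4
      have h6 : Tendsto (fun i => Complex.exp ((v / μ i : ℝ) : ℂ)) l (𝓝 1) := by
        have := (Complex.continuous_exp.tendsto _).comp
          ((Complex.continuous_ofReal.tendsto _).comp (hμ.const_div_atTop v))
        simpa [Function.comp_def] using this
      convert h6.mul h5 using 2
      · simp only [laplaceIntegrand, Function.comp]
        push_cast
        ring_nf
      · rw [one_mul]
        congr 1
        push_cast
        ring
    refine hlim.congr' ?_
    filter_upwards [hcut] with i hi
    simp only [hF, indicator_of_mem hi]

/-! ### Logarithmic coordinate and rotation of the contour -/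

/-- The integrand of `oscIntegral` in the coordinate `σ = log y`, in which it is entire. -/
noncomputable def logIntegrand (θ h : ℝ) (σ : ℂ) : ℂ :=
  Complex.exp σ * Complex.exp (-(Complex.exp σ) ^ 2 / h - 2 * Complex.I * Complex.exp σ / h -
    Complex.exp (-θ * σ))

lemma differentiable_logIntegrand (θ h : ℝ) : Differentiable ℂ (logIntegrand θ h) := by
  unfold logIntegrand
  fun_prop

lemma norm_logIntegrand (θ h x y : ℝ) :
    ‖logIntegrand θ h (x + y * Complex.I)‖ =
      Real.exp x * Real.exp (-(Real.exp x ^ 2 * Real.cos (2 * y)) / h +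
        2 * Real.exp x * Real.sin y / h - Real.exp (-θ * x) * Real.cos (θ * y)) := by
  have h1 : (-(Complex.exp (x + y * Complex.I)) ^ 2 / (h : ℂ)).re =
      -(Real.exp x ^ 2 * Real.cos (2 * y)) / h := by
    rw [← Complex.exp_nat_mul, Complex.div_ofReal_re, Complex.neg_re, Complex.exp_re]
    simp [← Real.exp_nat_mul]
  have h2 : (2 * Complex.I * Complex.exp (x + y * Complex.I) / (h : ℂ)).re =
      -(2 * Real.exp x * Real.sin y / h) := by
    rw [Complex.div_ofReal_re, mul_assoc, show (2 : ℂ) = ((2 : ℝ) : ℂ) by simp,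
      Complex.re_ofReal_mul, Complex.I_mul_re, Complex.exp_im]
    simp
    ring
  have h3 : (Complex.exp (-θ * (x + y * Complex.I))).re =
      Real.exp (-θ * x) * Real.cos (θ * y) := by
    rw [Complex.exp_re]
    simp
  rw [logIntegrand, norm_mul, Complex.norm_exp, Complex.norm_exp, Complex.sub_re, Complex.sub_re,
    h1, h2, h3]
  simp

/-- With r = e^x ≤ 1, -r² cos 2y + 2r sin y = -r² + 2r sin y (1 + r sin y) ≤ -r², even where cos 2y
< 0. The bound on θα keeps the flat factor from growing. -/
lemma norm_logIntegrand_le {θ h α x y : ℝ} (hθ : 0 ≤ θ) (hh : 0 < h) (hα : α ≤ Real.pi / 2)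
    (hθα : θ * α ≤ Real.pi / 2) (hx : x ≤ 0) (hy : y ∈ Icc (-α) 0) :
    ‖logIntegrand θ h (x + y * Complex.I)‖ ≤ Real.exp x * Real.exp (-Real.exp x ^ 2 / h) := by
  rw [norm_logIntegrand]
  obtain ⟨hy1, hy2⟩ := hy
  have hpi := Real.pi_pos
  have hs : Real.sin y ≤ 0 := Real.sin_nonpos_of_nonpos_of_neg_pi_le hy2 (by linarith)
  have hs' := Real.neg_one_le_sin y
  have hc : 0 ≤ Real.cos (θ * y) := Real.cos_nonneg_of_neg_pi_div_two_le_of_le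
    (by nlinarith) (by nlinarith)
  have hr : Real.exp x ≤ 1 := Real.exp_le_one_iff.2 hx
  have hr0 := Real.exp_pos x
  have hc2 : Real.cos (2 * y) = 1 - 2 * Real.sin y ^ 2 := by
    rw [Real.cos_two_mul, Real.cos_sq']; ring
  refine mul_le_mul_of_nonneg_left (Real.exp_le_exp.2 ?_) hr0.le
  have h1 : 0 ≤ Real.exp (-θ * x) * Real.cos (θ * y) := by positivity
  have h2 : -(Real.exp x ^ 2 * Real.cos (2 * y)) / h + 2 * Real.exp x * Real.sin y / h ≤
      -Real.exp x ^ 2 / h := by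
    rw [← add_div]
    gcongr
    rw [hc2]
    have h3 : 0 ≤ 1 + Real.exp x * Real.sin y := by nlinarith
    have h4 : 0 ≤ Real.exp x * (-Real.sin y) := by
      apply mul_nonneg hr0.le; linarith
    nlinarith [mul_nonneg h3 h4]
  linarith

lemma integrableOn_logIntegrand {θ h α b y : ℝ} (hθ : 0 ≤ θ) (hh : 0 < h) (hα : α ≤ Real.pi / 2)
    (hθα : θ * α ≤ Real.pi / 2) (hb : b ≤ 0) (hy : y ∈ Icc (-α) 0) :
    IntegrableOn (fun x : ℝ => logIntegrand θ h (x + y * Complex.I)) (Iic b) := by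
  refine Integrable.mono' (integrableOn_exp_Iic b) ?_ ?_
  · exact ((differentiable_logIntegrand θ h).continuous.comp
      (by fun_prop : Continuous fun x : ℝ => (x : ℂ) + y * Complex.I)).aestronglyMeasurable
  · refine (ae_restrict_iff' measurableSet_Iic).2 (Eventually.of_forall fun x hx => ?_)
    refine (norm_logIntegrand_le hθ hh hα hθα (le_trans hx hb) hy).trans ?_
    refine mul_le_of_le_one_right (Real.exp_pos _).le (Real.exp_le_one_iff.2 ?_)
    rw [neg_div]
    exact neg_nonpos.2 (by positivity)

/-- Cauchy's theorem on a rectangle: the left side vanishes as it recedes to -∞, and the right side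
is the error. -/
theorem norm_integral_logIntegrand_sub_le {θ h α b : ℝ} (hθ : 0 ≤ θ) (hh : 0 < h) (hα0 : 0 ≤ α)
    (hα : α ≤ Real.pi / 2) (hθα : θ * α ≤ Real.pi / 2) (hb : b ≤ 0) :
    ‖(∫ x : ℝ in Iic b, logIntegrand θ h x) -
      ∫ x : ℝ in Iic b, logIntegrand θ h (x + (-α : ℝ) * Complex.I)‖ ≤
      Real.exp b * Real.exp (-Real.exp b ^ 2 / h) * α := by
  set f := logIntegrand θ h with hf
  have hmem0 : (0 : ℝ) ∈ Icc (-α) 0 := ⟨by linarith, le_rfl⟩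
  have hmemα : (-α : ℝ) ∈ Icc (-α) 0 := ⟨le_rfl, by linarith⟩
  have hside : ∀ x : ℝ, x ≤ 0 → ‖∫ y : ℝ in (-α)..0, f (x + y * Complex.I)‖ ≤
      Real.exp x * Real.exp (-Real.exp x ^ 2 / h) * α := by
    intro x hx
    have := intervalIntegral.norm_integral_le_of_norm_le_const (a := -α) (b := 0)
      (f := fun y : ℝ => f (x + y * Complex.I)) (C := Real.exp x * Real.exp (-Real.exp x ^ 2 / h)) ?_
    · simpa [abs_of_nonneg hα0] using this
    · intro y hy
      rw [uIoc_of_le (by linarith)] at hy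
      exact norm_logIntegrand_le hθ hh hα hθα hx (Ioc_subset_Icc_self hy)
  have hrect : ∀ M : ℝ, (∫ x : ℝ in M..b, f x) - (∫ x : ℝ in M..b, f (x + (-α : ℝ) * Complex.I)) =
      Complex.I * (∫ y : ℝ in (-α)..0, f (b + y * Complex.I)) -
      Complex.I * (∫ y : ℝ in (-α)..0, f (M + y * Complex.I)) := by
    intro M
    have := Complex.integral_boundary_rect_eq_zero_of_differentiableOn f ⟨M, -α⟩ ⟨b, 0⟩
      (differentiable_logIntegrand θ h).differentiableOn
    simp only [smul_eq_mul, Complex.ofReal_zero, zero_mul, add_zero] at this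
    linear_combination -this
  have hleft : Tendsto (fun M : ℝ => ∫ y : ℝ in (-α)..0, f (M + y * Complex.I)) atBot (𝓝 0) := by
    have h1 : Tendsto (fun M : ℝ => Real.exp M * α) atBot (𝓝 0) := by
      simpa using Real.tendsto_exp_atBot.mul_const α
    refine squeeze_zero_norm' ?_ h1
    filter_upwards [eventually_le_atBot 0] with M hM
    refine (hside M hM).trans ?_
    gcongr
    refine mul_le_of_le_one_right (Real.exp_pos _).le (Real.exp_le_one_iff.2 ?_)
    rw [neg_div]
    exact neg_nonpos.2 (by positivity)
  have h1 := intervalIntegral_tendsto_integral_Iic b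
    (integrableOn_logIntegrand hθ hh hα hθα hb hmem0) tendsto_id
  have h2 := intervalIntegral_tendsto_integral_Iic b
    (integrableOn_logIntegrand hθ hh hα hθα hb hmemα) tendsto_id
  simp only [Complex.ofReal_zero, zero_mul, add_zero, id] at h1 h2
  have h3 := h1.sub h2
  have h4 := (hleft.const_mul Complex.I).const_sub
    (Complex.I * (∫ y : ℝ in (-α)..0, f (b + y * Complex.I)))
  rw [mul_zero, sub_zero] at h4
  have h5 := tendsto_nhds_unique h3 (h4.congr fun M => (hrect M).symm)
  rw [h5, norm_mul, Complex.norm_I, one_mul]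
  exact hside b hb

/-! ### Truncation of the original integral -/

lemma flatSymbol_nonneg (θ y : ℝ) : 0 ≤ flatSymbol θ y := by
  unfold flatSymbol
  split_ifs <;> positivity

lemma flatSymbol_le_one (θ y : ℝ) : flatSymbol θ y ≤ 1 := by
  unfold flatSymbol
  split_ifs with hy
  · exact Real.exp_le_one_iff.2 (neg_nonpos.2 (Real.rpow_nonneg hy.le _))
  · exact zero_le_one

lemma measurable_flatSymbol (θ : ℝ) : Measurable (flatSymbol θ) := by
  unfold flatSymbol
  refine Measurable.ite measurableSet_Ioi ?_ measurable_const
  fun_prop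

lemma norm_oscIntegrand_le (θ h y : ℝ) :
    ‖Complex.exp (-(y : ℂ) ^ 2 / (h : ℂ) - 2 * Complex.I * (y : ℂ) / (h : ℂ)) *
      (flatSymbol θ y : ℂ)‖ ≤ Real.exp (-(1 / h) * y ^ 2) := by
  rw [norm_mul, Complex.norm_exp, Complex.norm_real, Real.norm_of_nonneg (flatSymbol_nonneg _ _)]
  have h1 : (-(y : ℂ) ^ 2 / (h : ℂ) - 2 * Complex.I * (y : ℂ) / (h : ℂ)).re = -(1 / h) * y ^ 2 := by
    rw [show (-(y : ℂ) ^ 2 / (h : ℂ) - 2 * Complex.I * (y : ℂ) / (h : ℂ)) =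
      ((-(1 / h) * y ^ 2 : ℝ) : ℂ) + ((-2 * y / h : ℝ) : ℂ) * Complex.I by push_cast; ring]
    simp only [Complex.add_re, Complex.ofReal_re, Complex.re_ofReal_mul, Complex.I_re, mul_zero,
      add_zero]
  rw [h1]
  exact mul_le_of_le_one_right (Real.exp_pos _).le (flatSymbol_le_one _ _)

lemma integrable_oscIntegrand {h : ℝ} (hh : 0 < h) (θ : ℝ) :
    Integrable (fun y : ℝ =>
      Complex.exp (-(y : ℂ) ^ 2 / (h : ℂ) - 2 * Complex.I * (y : ℂ) / (h : ℂ)) *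
        (flatSymbol θ y : ℂ)) := by
  refine (integrable_exp_neg_mul_sq (b := 1 / h) (by positivity)).mono' ?_
    (Eventually.of_forall fun y => norm_oscIntegrand_le θ h y)
  have h1 : Continuous fun y : ℝ =>
      Complex.exp (-(y : ℂ) ^ 2 / (h : ℂ) - 2 * Complex.I * (y : ℂ) / (h : ℂ)) := by fun_prop
  exact (h1.measurable.mul
    (Complex.measurable_ofReal.comp (measurable_flatSymbol θ))).aestronglyMeasurable

lemma integral_Ioc_oscIntegrand (θ h b : ℝ) :
    ∫ y : ℝ in Ioc 0 (Real.exp b),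
      Complex.exp (-(y : ℂ) ^ 2 / (h : ℂ) - 2 * Complex.I * (y : ℂ) / (h : ℂ)) *
        (flatSymbol θ y : ℂ) = ∫ x : ℝ in Iic b, logIntegrand θ h x := by
  have himg : Real.exp '' Iic b = Ioc 0 (Real.exp b) := by
    ext y
    constructor
    · rintro ⟨x, hx, rfl⟩
      exact ⟨Real.exp_pos x, Real.exp_le_exp.2 hx⟩
    · rintro ⟨h0, h1⟩
      exact ⟨Real.log y, (Real.log_le_iff_le_exp h0).2 h1, Real.exp_log h0⟩
  rw [← himg, integral_image_eq_integral_abs_deriv_smul measurableSet_Iic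
    (fun x _ => (Real.hasDerivAt_exp x).hasDerivWithinAt) Real.exp_injective.injOn]
  refine setIntegral_congr_fun measurableSet_Iic fun x _ => ?_
  have h1 : flatSymbol θ (Real.exp x) = Real.exp (-Real.exp (-θ * x)) := by
    rw [flatSymbol, if_pos (Real.exp_pos x), Real.rpow_def_of_pos (Real.exp_pos x), Real.log_exp,
      mul_comm]
  simp only [h1, abs_of_pos (Real.exp_pos x), Complex.real_smul, logIntegrand]
  rw [Complex.ofReal_exp, Complex.ofReal_exp, ← Complex.exp_add]
  push_cast
  rfl

/-- Beyond the cutoff, half of y²/h supplies the exponential factor and the other half is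
integrated. The bound does not see x. -/
theorem norm_oscIntegral_sub_le {θ h b c₀ : ℝ} (hh : 0 < h) (hb : Real.exp b ≤ c₀) {x : EReal}
    (hx : (c₀ : EReal) ≤ x) :
    ‖oscIntegral θ h x - ∫ t : ℝ in Iic b, logIntegrand θ h t‖ ≤
      Real.exp (-(Real.exp b ^ 2 / (2 * h))) * Real.sqrt (2 * Real.pi * h) := by
  set r := Real.exp b with hr
  have hr0 : 0 < r := Real.exp_pos b
  set f : ℝ → ℂ := fun y =>
    Complex.exp (-(y : ℂ) ^ 2 / (h : ℂ) - 2 * Complex.I * (y : ℂ) / (h : ℂ)) *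
      (flatSymbol θ y : ℂ) with hf
  have hfi : Integrable f := integrable_oscIntegrand hh θ
  set S : Set ℝ := {y : ℝ | -x ≤ (y : EReal) ∧ (y : EReal) ≤ x} with hS
  have hSm : MeasurableSet S :=
    (measurableSet_le measurable_const measurable_coe_real_ereal).inter
      (measurableSet_le measurable_coe_real_ereal measurable_const)
  have hIoc : Ioc 0 r ⊆ S := by
    intro y hy
    have h1 : (y : EReal) ≤ x := (EReal.coe_le_coe_iff.2 (hy.2.trans hb)).trans hx
    refine ⟨?_, h1⟩
    rw [EReal.neg_le]
    refine le_trans ?_ h1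
    rw [← EReal.coe_neg]
    exact EReal.coe_le_coe_iff.2 (by linarith [hy.1])
  have hzero : ∀ y ≤ 0, f y = 0 := by
    intro y hy
    simp [hf, flatSymbol, not_lt.2 hy]
  have hsplit : oscIntegral θ h x = (∫ y in Ioc 0 r, f y) + ∫ y in S \ Ioc 0 r, f y := by
    have h1 := setIntegral_sdiff measurableSet_Ioc hfi.integrableOn hIoc (μ := volume) (f := f)
    rw [h1]
    change ∫ y in S, f y = _
    ring
  rw [hsplit, ← integral_Ioc_oscIntegrand, add_sub_cancel_left]
  have hg : Integrable fun y : ℝ => Real.exp (-(r ^ 2 / (2 * h))) *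
      Real.exp (-(1 / (2 * h)) * y ^ 2) :=
    (integrable_exp_neg_mul_sq (by positivity)).const_mul _
  calc ‖∫ y in S \ Ioc 0 r, f y‖ ≤ ∫ y in S \ Ioc 0 r, Real.exp (-(r ^ 2 / (2 * h))) *
        Real.exp (-(1 / (2 * h)) * y ^ 2) := by
        refine norm_integral_le_of_norm_le hg.integrableOn ?_
        refine (ae_restrict_iff' (hSm.diff measurableSet_Ioc)).2 (Eventually.of_forall fun y hy => ?_)
        rcases le_or_gt y 0 with h0 | h0
        · rw [hzero y h0, norm_zero]
          positivity
        · have h1 : r < y := by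
            by_contra hcon
            exact hy.2 ⟨h0, not_lt.1 hcon⟩
          refine (norm_oscIntegrand_le θ h y).trans ?_
          rw [← Real.exp_add]
          refine Real.exp_le_exp.2 ?_
          have h2 : r ^ 2 ≤ y ^ 2 := by gcongr
          have h3 : r ^ 2 / (2 * h) ≤ y ^ 2 / (2 * h) := by gcongr
          have h4 : -(1 / h) * y ^ 2 = -(y ^ 2 / (2 * h)) - (1 / (2 * h)) * y ^ 2 := by
            field_simp; ring
          rw [h4]
          linarith
    _ ≤ ∫ y, Real.exp (-(r ^ 2 / (2 * h))) * Real.exp (-(1 / (2 * h)) * y ^ 2) :=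
        setIntegral_le_integral hg (Eventually.of_forall fun y => by positivity)
    _ = _ := by
        rw [integral_const_mul, integral_gaussian]
        congr 2
        field_simp

/-! ### The saddle point and its perturbation -/

/-- The unperturbed phase `-2it - t^{-θ}` in the coordinate `τ = log t`. -/
noncomputable def logPhase (θ : ℝ) (τ : ℂ) : ℂ :=
  -2 * Complex.I * Complex.exp τ - Complex.exp (-θ * τ)

/-- The saddle point of `logPhase θ`. -/
noncomputable def saddlePoint (θ : ℝ) : ℂ :=
  ((Real.log (θ / 2) / (θ + 1) : ℝ) : ℂ) + ((-(Real.pi / (2 * (θ + 1))) : ℝ) : ℂ) * Complex.I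

lemma saddlePoint_re (θ : ℝ) : (saddlePoint θ).re = Real.log (θ / 2) / (θ + 1) := by
  rw [saddlePoint, Complex.add_re, Complex.re_ofReal_mul, Complex.ofReal_re, Complex.I_re]
  ring

lemma saddlePoint_im (θ : ℝ) : (saddlePoint θ).im = -(Real.pi / (2 * (θ + 1))) := by
  rw [saddlePoint, Complex.add_im, Complex.im_ofReal_mul, Complex.ofReal_im, Complex.I_im]
  ring

lemma mul_exp_saddlePoint {θ : ℝ} (hθ : 0 < θ) :
    (θ : ℂ) * Complex.exp (-(θ + 1) * saddlePoint θ) = 2 * Complex.I := by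
  have h1 : -((θ : ℂ) + 1) * saddlePoint θ =
      ((-Real.log (θ / 2) : ℝ) : ℂ) + Real.pi / 2 * Complex.I := by
    have h2 : (θ : ℂ) + 1 ≠ 0 := by
      exact_mod_cast (by positivity : θ + 1 ≠ 0)
    unfold saddlePoint
    push_cast
    field_simp
    ring
  rw [h1, Complex.exp_add, Complex.exp_pi_div_two_mul_I, ← Complex.ofReal_exp, Real.exp_neg,
    Real.exp_log (by positivity)]
  have h3 : (θ : ℂ) ≠ 0 := by exact_mod_cast hθ.ne'
  push_cast
  field_simp

lemma mul_exp_neg_mul_saddlePoint {θ : ℝ} (hθ : 0 < θ) :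
    (θ : ℂ) * Complex.exp (-θ * saddlePoint θ) = 2 * Complex.I * Complex.exp (saddlePoint θ) := by
  rw [← mul_exp_saddlePoint hθ, mul_assoc, ← Complex.exp_add]
  ring_nf

/-- For every small `ε` the perturbed phase `logPhase θ τ - ε e^{2τ}` has a saddle point
`O(ε)`-close to that of `logPhase θ`. -/
theorem exists_perturbed_saddlePoint {θ : ℝ} (hθ : 0 < θ) :
    ∃ τ : ℝ → ℂ, (∀ᶠ ε : ℝ in 𝓝 0, 2 * (ε : ℂ) * Complex.exp (2 * τ ε) =
        -2 * Complex.I * Complex.exp (τ ε) + θ * Complex.exp (-θ * τ ε)) ∧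
      (fun ε => τ ε - saddlePoint θ) =O[𝓝 0] (fun ε : ℝ => ε) := by
  -- The saddle equation divided by 2e^(2τ) reads E τ = ε, so the perturbed saddle is a local
  -- inverse of E, evaluated at ε.
  set E : ℂ → ℂ := fun τ =>
    -Complex.I * Complex.exp (-τ) + θ / 2 * Complex.exp (-(θ + 2) * τ) with hE
  set τ₀ := saddlePoint θ with hτ₀
  have hexp : (θ : ℂ) * Complex.exp (-(θ + 2) * τ₀) = 2 * Complex.I * Complex.exp (-τ₀) := by
    rw [hτ₀, ← mul_exp_saddlePoint hθ, mul_assoc, ← Complex.exp_add]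
    ring_nf
  have hE0 : E τ₀ = 0 := by
    simp only [hE]
    linear_combination (1 / 2) * hexp
  have hder : HasStrictDerivAt E (-(θ + 1) * Complex.I * Complex.exp (-τ₀)) τ₀ := by
    have h1 : HasStrictDerivAt (fun τ : ℂ => Complex.exp (-τ)) (Complex.exp (-τ₀) * (-1)) τ₀ :=
      (hasStrictDerivAt_id τ₀).neg.cexp
    have h2 : HasStrictDerivAt (fun τ : ℂ => Complex.exp (-(θ + 2) * τ))
        (Complex.exp (-(θ + 2) * τ₀) * (-(θ + 2) * 1)) τ₀ :=
      ((hasStrictDerivAt_id τ₀).const_mul _).cexp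
    have h3 := (h1.const_mul (-Complex.I)).add (h2.const_mul (θ / 2 : ℂ))
    have h4 : -Complex.I * (Complex.exp (-τ₀) * (-1)) +
        θ / 2 * (Complex.exp (-(θ + 2) * τ₀) * (-(θ + 2) * 1)) =
        -(θ + 1) * Complex.I * Complex.exp (-τ₀) := by
      linear_combination (-(θ + 2) / 2 : ℂ) * hexp
    rwa [h4] at h3
  have hne : -((θ : ℂ) + 1) * Complex.I * Complex.exp (-τ₀) ≠ 0 := by
    have h2 : (θ : ℂ) + 1 ≠ 0 := by
      exact_mod_cast (by positivity : θ + 1 ≠ 0)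
    exact mul_ne_zero (mul_ne_zero (neg_ne_zero.2 h2) Complex.I_ne_zero) (Complex.exp_ne_zero _)
  have hof : Tendsto (fun ε : ℝ => (ε : ℂ)) (𝓝 0) (𝓝 (E τ₀)) := by
    rw [hE0]
    exact Complex.continuous_ofReal.tendsto' 0 0 Complex.ofReal_zero
  refine ⟨fun ε => hder.localInverse E _ τ₀ hne ε, ?_, ?_⟩
  · filter_upwards [hof.eventually (hder.eventually_right_inverse hne)] with ε hε
    set w := hder.localInverse E _ τ₀ hne ε
    rw [← hε]
    simp only [hE]
    have h1 : Complex.exp (-w) * Complex.exp (2 * w) = Complex.exp w := by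
      rw [← Complex.exp_add]; ring_nf
    have h2 : Complex.exp (-(θ + 2) * w) * Complex.exp (2 * w) = Complex.exp (-θ * w) := by
      rw [← Complex.exp_add]; ring_nf
    rw [← h1, ← h2]
    ring
  · have h1 := (hder.to_localInverse hne).hasDerivAt.isBigO_sub
    have h2 := h1.comp_tendsto hof
    have h3 : hder.localInverse E _ τ₀ hne (E τ₀) = τ₀ :=
      (hder.hasStrictFDerivAt_equiv hne).localInverse_apply_image
    rw [h3] at h2
    refine h2.trans ?_
    refine IsBigO.of_bound 1 (Eventually.of_forall fun ε => ?_)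
    simp [hE0]

lemma isBigO_exp_sub_one_sub_id :
    (fun w : ℂ => Complex.exp w - 1 - w) =O[𝓝 0] (fun w => w ^ 2) := by
  refine IsBigO.of_bound 1 ?_
  filter_upwards [Metric.closedBall_mem_nhds (0 : ℂ) one_pos] with w hw
  rw [one_mul, norm_pow]
  exact Complex.norm_exp_sub_one_sub_id_le (by simpa using hw)

lemma isBigO_exp_sub_one : (fun w : ℂ => Complex.exp w - 1) =O[𝓝 0] (fun w => w) := by
  simpa using (Complex.hasDerivAt_exp 0).isBigO_sub

/-- The first-order change of `logPhase` vanishes at its saddle, and the perturbation term changes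
by ε · O(ε). -/
lemma isBigO_logPhase_sub {θ : ℝ} (hθ : 0 < θ) {τ : ℝ → ℂ}
    (hτ : (fun ε => τ ε - saddlePoint θ) =O[𝓝 0] (fun ε : ℝ => ε)) :
    (fun ε : ℝ => (logPhase θ (τ ε) - ε * Complex.exp (2 * τ ε)) -
      (logPhase θ (saddlePoint θ) - ε * Complex.exp (2 * saddlePoint θ))) =O[𝓝 0]
      (fun ε : ℝ => ε ^ 2) := by
  set τ₀ := saddlePoint θ with hτ₀
  have h0 := mul_exp_neg_mul_saddlePoint hθ
  have hw : Tendsto (fun ε => τ ε - τ₀) (𝓝 0) (𝓝 0) := hτ.trans_tendsto tendsto_id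
  have hscale : ∀ a : ℂ, Tendsto (fun ε => a * (τ ε - τ₀)) (𝓝 0) (𝓝 0) := fun a => by
    simpa using hw.const_mul a
  have hO : ∀ a : ℂ, (fun ε => a * (τ ε - τ₀)) =O[𝓝 0] (fun ε : ℝ => ε) := fun a =>
    hτ.const_mul_left a
  have h1 : ∀ a : ℂ, (fun ε => Complex.exp (a * (τ ε - τ₀)) - 1 - a * (τ ε - τ₀)) =O[𝓝 0]
      (fun ε : ℝ => ε ^ 2) := fun a =>
    (isBigO_exp_sub_one_sub_id.comp_tendsto (hscale a)).trans ((hO a).pow 2)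
  have h2 : (fun ε => Complex.exp (2 * (τ ε - τ₀)) - 1) =O[𝓝 0] (fun ε : ℝ => ε) :=
    (isBigO_exp_sub_one.comp_tendsto (hscale 2)).trans (hO 2)
  have h3 : (fun ε : ℝ => (ε : ℂ)) =O[𝓝 0] (fun ε : ℝ => ε) :=
    IsBigO.of_bound 1 (Eventually.of_forall fun ε => by simp)
  have h4 := ((h1 1).const_mul_left (-θ * Complex.exp (-θ * τ₀))).add
    ((h1 (-θ)).const_mul_left (-Complex.exp (-θ * τ₀)))
  have h5 : (fun ε : ℝ => (ε : ℂ) * (Complex.exp (2 * (τ ε - τ₀)) - 1)) =O[𝓝 0]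
      (fun ε : ℝ => ε ^ 2) := by
    simpa [sq] using h3.mul h2
  refine (h4.sub (h5.const_mul_left (Complex.exp (2 * τ₀)))).congr_left fun ε => ?_
  have e1 : Complex.exp (τ ε) = Complex.exp τ₀ * Complex.exp (1 * (τ ε - τ₀)) := by
    rw [← Complex.exp_add]; ring_nf
  have e2 : Complex.exp (-θ * τ ε) = Complex.exp (-θ * τ₀) * Complex.exp (-θ * (τ ε - τ₀)) := by
    rw [← Complex.exp_add]; ring_nf
  have e3 : Complex.exp (2 * τ ε) = Complex.exp (2 * τ₀) * Complex.exp (2 * (τ ε - τ₀)) := by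
    rw [← Complex.exp_add]; ring_nf
  unfold logPhase
  rw [e1, e2, e3]
  linear_combination (1 - Complex.exp (1 * (τ ε - τ₀))) * h0

/-! ### The integrand on the ray through the perturbed saddle -/

/-- An exact identity, not an expansion: the saddle equation eliminates e^τ, and the ε-terms combine
into a perfect square. -/
lemma logPhase_add {θ ε : ℝ} {τ : ℂ}
    (hτ : 2 * (ε : ℂ) * Complex.exp (2 * τ) =
      -2 * Complex.I * Complex.exp τ + θ * Complex.exp (-θ * τ)) (z : ℝ) :
    logPhase θ (τ + z) - ε * Complex.exp (2 * (τ + z)) =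
      (logPhase θ τ - ε * Complex.exp (2 * τ)) -
        (Complex.exp (-θ * τ) * (phaseWell θ z : ℝ) +
          ε * Complex.exp (2 * τ) * ((Real.exp z - 1 : ℝ) : ℂ) ^ 2) := by
  have e1 : Complex.exp (τ + z) = Complex.exp τ * Complex.exp z := Complex.exp_add _ _
  have e2 : Complex.exp (-θ * (τ + z)) = Complex.exp (-θ * τ) * Complex.exp (-θ * z) := by
    rw [← Complex.exp_add]; ring_nf
  have e3 : Complex.exp (2 * (τ + z)) = Complex.exp (2 * τ) * Complex.exp z ^ 2 := by
    rw [← Complex.exp_nat_mul, ← Complex.exp_add]; push_cast; ring_nf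
  unfold logPhase phaseWell
  rw [e1, e2, e3]
  push_cast
  linear_combination (1 - Complex.exp z) * hτ

lemma logIntegrand_log_add {θ ε μ h : ℝ} {τ : ℂ} (hε : 0 < ε) (hμ : 0 < μ)
    (hh : h = ε / μ ^ 2) (hμε : Real.exp (-θ * Real.log ε) = μ ^ 2)
    (hτ : 2 * (ε : ℂ) * Complex.exp (2 * τ) =
      -2 * Complex.I * Complex.exp τ + θ * Complex.exp (-θ * τ)) (z : ℝ) :
    logIntegrand θ h (Real.log ε + (τ + z)) =
      ε * Complex.exp τ *
        Complex.exp ((μ : ℂ) ^ 2 * (logPhase θ τ - ε * Complex.exp (2 * τ))) *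
        laplaceIntegrand θ ε μ (Complex.exp (-θ * τ)) (Complex.exp (2 * τ)) z := by
  have h1 : Complex.exp (Real.log ε + (τ + z)) = ε * Complex.exp (τ + z) := by
    rw [Complex.exp_add, ← Complex.ofReal_exp, Real.exp_log hε]
  have h2 : Complex.exp (-θ * (Real.log ε + (τ + z))) =
      (μ : ℂ) ^ 2 * Complex.exp (-θ * (τ + z)) := by
    rw [mul_add, Complex.exp_add]
    congr 1
    rw [← Complex.ofReal_pow, ← hμε, Complex.ofReal_exp]
    push_cast
    rfl
  have hε' : (ε : ℂ) ≠ 0 := by exact_mod_cast hε.ne'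
  have hμ' : (μ : ℂ) ≠ 0 := by exact_mod_cast hμ.ne'
  have h3 : -(ε * Complex.exp (τ + z)) ^ 2 / (h : ℂ) -
      2 * Complex.I * (ε * Complex.exp (τ + z)) / (h : ℂ) -
      (μ : ℂ) ^ 2 * Complex.exp (-θ * (τ + z)) =
      (μ : ℂ) ^ 2 * (logPhase θ (τ + z) - ε * Complex.exp (2 * (τ + z))) := by
    have e3 : Complex.exp (2 * (τ + z)) = Complex.exp (τ + z) ^ 2 := by
      rw [← Complex.exp_nat_mul]; push_cast; rfl
    rw [hh, e3]
    unfold logPhase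
    push_cast
    field_simp
    ring
  rw [logIntegrand, h1, h2, h3, logPhase_add hτ, laplaceIntegrand, Complex.exp_add, mul_sub,
    sub_eq_add_neg ((μ : ℂ) ^ 2 * _), Complex.exp_add]
  ring

lemma integral_logIntegrand_eq {θ ε μ h b : ℝ} {τ : ℂ} (hε : 0 < ε) (hμ : 0 < μ)
    (hh : h = ε / μ ^ 2) (hμε : Real.exp (-θ * Real.log ε) = μ ^ 2)
    (hτ : 2 * (ε : ℂ) * Complex.exp (2 * τ) =
      -2 * Complex.I * Complex.exp τ + θ * Complex.exp (-θ * τ)) :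
    ∫ x : ℝ in Iic b, logIntegrand θ h (x + τ.im * Complex.I) =
      ε * Complex.exp τ *
        Complex.exp ((μ : ℂ) ^ 2 * (logPhase θ τ - ε * Complex.exp (2 * τ))) *
        ∫ z : ℝ in Iic (b - (Real.log ε + τ.re)),
          laplaceIntegrand θ ε μ (Complex.exp (-θ * τ)) (Complex.exp (2 * τ)) z := by
  rw [← integral_const_mul]
  have h1 := (measurePreserving_add_right volume (Real.log ε + τ.re)).setIntegral_preimage_emb
    (measurableEmbedding_addRight _) (fun x : ℝ => logIntegrand θ h (x + τ.im * Complex.I)) (Iic b)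
  rw [← h1]
  have h2 : (fun x : ℝ => x + (Real.log ε + τ.re)) ⁻¹' Iic b = Iic (b - (Real.log ε + τ.re)) := by
    ext x
    simp [le_sub_iff_add_le]
  rw [h2]
  refine setIntegral_congr_fun measurableSet_Iic fun z _ => ?_
  rw [← logIntegrand_log_add hε hμ hh hμε hτ]
  congr 1
  conv_rhs => rw [← Complex.re_add_im τ]
  push_cast
  ring

/-! ### Signs at the saddle -/

/-- The argument is (π/2) θ/(θ+1) < π/2. This positivity gives both the decay along the ray and c >
0. -/
lemma exp_neg_mul_saddlePoint_re_pos {θ : ℝ} (hθ : 0 < θ) :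
    0 < (Complex.exp (-θ * saddlePoint θ)).re := by
  have hpi := Real.pi_pos
  have h1 : (-(θ : ℂ) * saddlePoint θ).im = θ / (θ + 1) * (Real.pi / 2) := by
    rw [← Complex.ofReal_neg, Complex.im_ofReal_mul, saddlePoint_im]
    field_simp
  have h2 : θ / (θ + 1) < 1 := by
    rw [div_lt_one (by positivity)]
    linarith
  have h3 : 0 ≤ θ / (θ + 1) := by positivity
  rw [Complex.exp_re, h1]
  refine mul_pos (Real.exp_pos _) (Real.cos_pos_of_mem_Ioo ⟨?_, ?_⟩)
  · nlinarith
  · nlinarith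

lemma logPhase_saddlePoint_re_neg {θ : ℝ} (hθ : 0 < θ) : (logPhase θ (saddlePoint θ)).re < 0 := by
  have h1 : logPhase θ (saddlePoint θ) =
      ((-(θ + 1) : ℝ) : ℂ) * Complex.exp (-θ * saddlePoint θ) := by
    unfold logPhase
    push_cast
    linear_combination mul_exp_neg_mul_saddlePoint hθ
  rw [h1, Complex.re_ofReal_mul]
  have := exp_neg_mul_saddlePoint_re_pos hθ
  nlinarith

lemma integral_exp_neg_mul_sq_ne_zero {b : ℂ} (hb : 0 < b.re) :
    ∫ v : ℝ, Complex.exp (-b * (v : ℂ) ^ 2) ≠ 0 := by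
  have hb0 : b ≠ 0 := by
    rintro rfl
    simp at hb
  rw [integral_gaussian_complex hb]
  refine fun h => ?_
  rw [Complex.cpow_eq_zero_iff] at h
  exact div_ne_zero (by exact_mod_cast Real.pi_ne_zero) hb0 h.1

/-! ### Two-sided bound for the integral -/

theorem eventually_oscIntegral_bounds {θ : ℝ} (hθ : 0 < θ) {ε μ : ℝ → ℝ} {τ : ℝ → ℂ}
    (hε0 : ∀ h > 0, 0 < ε h) (hμ0 : ∀ h > 0, 0 < μ h)
    (hε : Tendsto ε (𝓝[>] 0) (𝓝 0)) (hμ : Tendsto μ (𝓝[>] 0) atTop)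
    (hh : ∀ h > 0, h = ε h / μ h ^ 2)
    (hμε : ∀ h > 0, Real.exp (-θ * Real.log (ε h)) = μ h ^ 2)
    (hsmall : ∀ b > 0, ∀ M : ℝ, Tendsto (fun h => Real.exp (-(b / h)) *
      (μ h / ε h * Real.exp (M * μ h ^ 2))) (𝓝[>] 0) (𝓝 0))
    (hτ : ∀ᶠ h in 𝓝[>] 0, 2 * (ε h : ℂ) * Complex.exp (2 * τ h) =
      -2 * Complex.I * Complex.exp (τ h) + θ * Complex.exp (-θ * τ h))
    (hτlim : Tendsto τ (𝓝[>] 0) (𝓝 (saddlePoint θ))) {c₀ : ℝ} (hc₀ : 0 < c₀) :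
    ∃ C : ℝ, 0 < C ∧ ∀ᶠ h in 𝓝[>] (0 : ℝ), ∀ x : EReal, (c₀ : EReal) ≤ x →
      C⁻¹ * (ε h / μ h * ‖Complex.exp ((μ h : ℂ) ^ 2 *
        (logPhase θ (τ h) - ε h * Complex.exp (2 * τ h)))‖) ≤ ‖oscIntegral θ h x‖ ∧
      ‖oscIntegral θ h x‖ ≤ C * (ε h / μ h * ‖Complex.exp ((μ h : ℂ) ^ 2 *
        (logPhase θ (τ h) - ε h * Complex.exp (2 * τ h)))‖) := by
  set τ₀ := saddlePoint θ with hτ₀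
  set m := min θ (θ ^ 2) with hm
  have hm0 : 0 < m := lt_min hθ (by positivity)
  have hpi := Real.pi_pos
  set A : ℝ → ℂ := fun h => Complex.exp (-θ * τ h) with hAdef
  set B : ℝ → ℂ := fun h => Complex.exp (2 * τ h) with hBdef
  set A₀ := Complex.exp (-θ * τ₀) with hA₀
  set B₀ := Complex.exp (2 * τ₀) with hB₀
  have hApos : 0 < A₀.re := exp_neg_mul_saddlePoint_re_pos hθ
  have hA : Tendsto A (𝓝[>] 0) (𝓝 A₀) :=
    (Complex.continuous_exp.tendsto _).comp (hτlim.const_mul _)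
  have hB : Tendsto B (𝓝[>] 0) (𝓝 B₀) :=
    (Complex.continuous_exp.tendsto _).comp (hτlim.const_mul _)
  have hτre : Tendsto (fun h => (τ h).re) (𝓝[>] 0) (𝓝 τ₀.re) :=
    (Complex.continuous_re.tendsto _).comp hτlim
  have hτim : Tendsto (fun h => (τ h).im) (𝓝[>] 0) (𝓝 τ₀.im) :=
    (Complex.continuous_im.tendsto _).comp hτlim
  have hεpos : ∀ᶠ h in 𝓝[>] (0 : ℝ), 0 < ε h := by
    filter_upwards [self_mem_nhdsWithin] with h h0 using hε0 h h0
  -- The cutoff `y = e^b` keeps the quadratic perturbation small along the ray.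
  set ρ := A₀.re / 4 * (m / 2) / (‖B₀‖ + 1) with hρ
  have hρ0 : 0 < ρ := by positivity
  -- The bound 1 serves the contour side, c₀ the uniformity in x, and the last one gives ε e^Z ≤ ρ;
  -- its factor 1/2 allows for the motion of the saddle.
  set r := min (min 1 c₀) (ρ * (Real.exp τ₀.re / 2)) with hr
  have hr0 : 0 < r := lt_min (lt_min one_pos hc₀) (by positivity)
  have hr1 : r ≤ 1 := (min_le_left _ _).trans (min_le_left _ _)
  have hrc : r ≤ c₀ := (min_le_left _ _).trans (min_le_right _ _)
  have hrρ : r ≤ ρ * (Real.exp τ₀.re / 2) := min_le_right _ _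
  set b := Real.log r with hb
  have hexpb : Real.exp b = r := Real.exp_log hr0
  have hb0 : b ≤ 0 := Real.log_nonpos hr0.le hr1
  set Z : ℝ → ℝ := fun h => b - (Real.log (ε h) + (τ h).re) with hZdef
  have hZ : Tendsto Z (𝓝[>] 0) atTop := by
    have h1 : Tendsto (fun h => Real.log (ε h)) (𝓝[>] 0) atBot :=
      Real.tendsto_log_nhdsGT_zero.comp
        (tendsto_nhdsWithin_iff.2 ⟨hε, hεpos⟩)
    exact tendsto_atTop_add_const_left _ b (tendsto_neg_atBot_atTop.comp (h1.atBot_add hτre))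
  have hZρ : ∀ᶠ h in 𝓝[>] (0 : ℝ), ε h * Real.exp (Z h) ≤ ρ := by
    have h1 : ∀ᶠ h in 𝓝[>] (0 : ℝ), Real.exp τ₀.re / 2 ≤ Real.exp (τ h).re :=
      ((Real.continuous_exp.tendsto _).comp hτre).eventually_const_le
        (by linarith [Real.exp_pos τ₀.re])
    filter_upwards [h1, hεpos] with h h2 h3
    simp only [hZdef]
    rw [Real.exp_sub, Real.exp_add, Real.exp_log h3, hexpb]
    have h4 : ε h * (r / (ε h * Real.exp (τ h).re)) = r / Real.exp (τ h).re := by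
      field_simp
    rw [h4, div_le_iff₀ (Real.exp_pos _)]
    exact hrρ.trans (by gcongr)
  have hAB : ∀ᶠ h in 𝓝[>] (0 : ℝ), A₀.re / 4 ≤ (A h).re - ‖B h‖ * (2 / m * ρ) := by
    have h1 : ∀ᶠ h in 𝓝[>] (0 : ℝ), A₀.re / 2 ≤ (A h).re :=
      ((Complex.continuous_re.tendsto _).comp hA).eventually_const_le (by linarith)
    have h2 : ∀ᶠ h in 𝓝[>] (0 : ℝ), ‖B h‖ ≤ ‖B₀‖ + 1 :=
      hB.norm.eventually_le_const (by linarith)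
    filter_upwards [h1, h2] with h h3 h4
    have h5 : ‖B h‖ * (2 / m * ρ) ≤ (‖B₀‖ + 1) * (2 / m * ρ) := by gcongr
    have h6 : (‖B₀‖ + 1) * (2 / m * ρ) = A₀.re / 4 := by
      have : ‖B₀‖ + 1 ≠ 0 := by positivity
      rw [hρ]
      field_simp
    linarith
  set J : ℝ → ℂ := fun h => ∫ z in Iic (Z h), laplaceIntegrand θ (ε h) (μ h) (A h) (B h) z
    with hJ
  set L : ℂ := Complex.exp τ₀ *
    ∫ v : ℝ, Complex.exp (-(A₀ * ((θ * (θ + 1) / 2 : ℝ) : ℂ)) * (v : ℂ) ^ 2) with hL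
  have hlim : Tendsto (fun h => ‖Complex.exp (τ h) * ((μ h : ℂ) * J h)‖) (𝓝[>] 0) (𝓝 ‖L‖) :=
    (((Complex.continuous_exp.tendsto _).comp hτlim).mul
      (tendsto_mul_integral_laplaceIntegrand hθ (by positivity : 0 < A₀.re / 4) hA hB hε hμ hZ
        (hεpos.mono fun _ h => h.le) (hε.eventually_le_const hρ0) hZρ hAB)).norm
  have hL0 : 0 < ‖L‖ := by
    refine norm_pos_iff.2 (mul_ne_zero (Complex.exp_ne_zero _)
      (integral_exp_neg_mul_sq_ne_zero ?_))
    rw [mul_comm, Complex.re_ofReal_mul]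
    positivity
  -- The errors made by cutting off the integral and rotating the contour.
  set P : ℝ → ℂ := fun h => logPhase θ (τ h) - ε h * Complex.exp (2 * τ h) with hP
  have hPlim : Tendsto P (𝓝[>] 0) (𝓝 (logPhase θ τ₀)) := by
    have h1 : Continuous (logPhase θ) := by unfold logPhase; fun_prop
    have h2 := ((h1.tendsto _).comp hτlim).sub
      (((Complex.continuous_ofReal.tendsto _).comp hε).mul hB)
    simpa using h2
  set M := ‖logPhase θ τ₀‖ + 1 with hM
  -- π/2 bounds the rotation angle; √(2π) comes from the Gaussian tail.
  set C₁ := Real.pi / 2 + Real.sqrt (2 * Real.pi) with hC₁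
  -- The error bound divided by (ε/μ) e^(-Mμ²), a lower bound for the size of the main term up to a
  -- constant.
  set T : ℝ → ℝ := fun h => C₁ * (Real.exp (-((r ^ 2 / 2) / h)) *
    (μ h / ε h * Real.exp (M * μ h ^ 2))) with hT
  have hTlim : Tendsto T (𝓝[>] 0) (𝓝 0) := by
    simpa using (hsmall (r ^ 2 / 2) (by positivity) M).const_mul C₁
  have him1 : ∀ᶠ h in 𝓝[>] (0 : ℝ), (τ h).im ≤ 0 :=
    hτim.eventually_le_const (by rw [hτ₀, saddlePoint_im]; exact neg_neg_of_pos (by positivity))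
  have him2 : ∀ᶠ h in 𝓝[>] (0 : ℝ), -(Real.pi / 2) ≤ (τ h).im := by
    refine hτim.eventually_const_le ?_
    rw [hτ₀, saddlePoint_im, neg_lt_neg_iff]
    gcongr
    linarith
  have him3 : ∀ᶠ h in 𝓝[>] (0 : ℝ), -(Real.pi / 2) ≤ θ * (τ h).im := by
    refine (hτim.const_mul θ).eventually_const_le ?_
    rw [hτ₀, saddlePoint_im, mul_neg, neg_lt_neg_iff, ← mul_div_assoc,
      div_lt_div_iff₀ (by positivity) (by positivity)]
    nlinarith
  have hmain : ∀ᶠ h in 𝓝[>] (0 : ℝ), ∀ x : EReal, (c₀ : EReal) ≤ x →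
      ‖oscIntegral θ h x - (ε h / μ h : ℝ) * Complex.exp ((μ h : ℂ) ^ 2 * P h) *
        (Complex.exp (τ h) * ((μ h : ℂ) * J h))‖ ≤
      T h * (ε h / μ h * ‖Complex.exp ((μ h : ℂ) ^ 2 * P h)‖) := by
    have hle1 : ∀ᶠ h in 𝓝[>] (0 : ℝ), h ≤ 1 :=
      (tendsto_id.mono_left nhdsWithin_le_nhds).eventually_le_const (zero_lt_one' ℝ)
    filter_upwards [self_mem_nhdsWithin, hle1, him1, him2, him3, hτ,
      hPlim.norm.eventually_le_const (lt_add_one _)] with h h0 h1 hi1 hi2 hi3 hτh hPh x hx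
    have hpos : 0 < h := h0
    have hμh := hμ0 h h0
    have hεh := hε0 h h0
    have hμc : (μ h : ℂ) ≠ 0 := by exact_mod_cast hμh.ne'
    have e1 := norm_oscIntegral_sub_le (θ := θ) hpos (hexpb.trans_le hrc) hx
    have e2 := norm_integral_logIntegrand_sub_le (α := -(τ h).im) hθ.le hpos (by linarith)
      (by linarith) (by linarith) hb0
    rw [neg_neg, integral_logIntegrand_eq hεh hμh (hh h h0) (hμε h h0) hτh] at e2
    have e3 : (ε h / μ h : ℝ) * Complex.exp ((μ h : ℂ) ^ 2 * P h) *
        (Complex.exp (τ h) * ((μ h : ℂ) * J h)) = ε h * Complex.exp (τ h) *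
        Complex.exp ((μ h : ℂ) ^ 2 * (logPhase θ (τ h) - ε h * Complex.exp (2 * τ h))) * J h := by
      push_cast
      simp only [hP]
      field_simp
    rw [e3]
    refine (norm_sub_le_norm_sub_add_norm_sub _
      (∫ t : ℝ in Iic b, logIntegrand θ h t) _).trans ((add_le_add e1 e2).trans ?_)
    rw [hexpb]
    have e4 : Real.exp (-M * μ h ^ 2) ≤ ‖Complex.exp ((μ h : ℂ) ^ 2 * P h)‖ := by
      rw [Complex.norm_exp, ← Complex.ofReal_pow, Complex.re_ofReal_mul]
      refine Real.exp_le_exp.2 ?_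
      have h5 : -M ≤ (P h).re := (neg_le_neg hPh).trans (abs_le.1 (Complex.abs_re_le_norm _)).1
      nlinarith [sq_nonneg (μ h)]
    have e5 : C₁ * Real.exp (-((r ^ 2 / 2) / h)) ≤
        T h * (ε h / μ h * ‖Complex.exp ((μ h : ℂ) ^ 2 * P h)‖) := by
      have h6 : T h * (ε h / μ h * Real.exp (-M * μ h ^ 2)) =
          C₁ * Real.exp (-((r ^ 2 / 2) / h)) := by
        simp only [hT]
        rw [neg_mul, Real.exp_neg (M * _)]
        field_simp
      rw [← h6]
      gcongr
    refine le_trans ?_ e5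
    have e6 : -(r ^ 2 / (2 * h)) = -((r ^ 2 / 2) / h) := by
      rw [div_div]
    have e7 : Real.exp (-r ^ 2 / h) ≤ Real.exp (-((r ^ 2 / 2) / h)) := by
      rw [neg_div]
      gcongr
      have : 0 ≤ r ^ 2 := sq_nonneg r
      linarith
    have e8 : Real.sqrt (2 * Real.pi * h) ≤ Real.sqrt (2 * Real.pi) := by
      apply Real.sqrt_le_sqrt
      nlinarith
    rw [e6, hC₁, add_mul, add_comm]
    have e9 : r * Real.exp (-r ^ 2 / h) * -(τ h).im ≤
        1 * Real.exp (-((r ^ 2 / 2) / h)) * (Real.pi / 2) := by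
      gcongr
      · linarith
      · linarith
    have e10 : Real.exp (-((r ^ 2 / 2) / h)) * Real.sqrt (2 * Real.pi * h) ≤
        Real.exp (-((r ^ 2 / 2) / h)) * Real.sqrt (2 * Real.pi) := by gcongr
    linarith
  have hlow : ∀ᶠ h in 𝓝[>] (0 : ℝ), ‖L‖ / 2 ≤ ‖Complex.exp (τ h) * ((μ h : ℂ) * J h)‖ :=
    hlim.eventually_const_le (by linarith)
  have hup : ∀ᶠ h in 𝓝[>] (0 : ℝ), ‖Complex.exp (τ h) * ((μ h : ℂ) * J h)‖ ≤ 2 * ‖L‖ :=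
    hlim.eventually_le_const (by linarith)
  have hTs : ∀ᶠ h in 𝓝[>] (0 : ℝ), T h ≤ ‖L‖ / 4 :=
    hTlim.eventually_le_const (by positivity)
  -- Relative to ε/μ times the exponential, the main term lies in [‖L‖/2, 2‖L‖] and the error is at
  -- most ‖L‖/4.
  refine ⟨3 * ‖L‖ + 4 / ‖L‖, by positivity, ?_⟩
  filter_upwards [hmain, hlow, hup, hTs, self_mem_nhdsWithin] with h h1 h2 h3 h4 h0 x hx
  have h5 := h1 x hx
  set N := ε h / μ h * ‖Complex.exp ((μ h : ℂ) ^ 2 * P h)‖ with hN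
  have hN0 : 0 ≤ N := mul_nonneg (div_nonneg (hε0 h h0).le (hμ0 h h0).le) (norm_nonneg _)
  have h6 : ‖(ε h / μ h : ℝ) * Complex.exp ((μ h : ℂ) ^ 2 * P h) *
        (Complex.exp (τ h) * ((μ h : ℂ) * J h))‖ =
        N * ‖Complex.exp (τ h) * ((μ h : ℂ) * J h)‖ := by
    rw [norm_mul, norm_mul, Complex.norm_real,
      Real.norm_of_nonneg (div_nonneg (hε0 h h0).le (hμ0 h h0).le)]
  have h7 : T h * N ≤ ‖L‖ / 4 * N := by gcongr
  have h8 : N * (‖L‖ / 2) ≤ N * ‖Complex.exp (τ h) * ((μ h : ℂ) * J h)‖ := by gcongr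
  have h9 : N * ‖Complex.exp (τ h) * ((μ h : ℂ) * J h)‖ ≤ N * (2 * ‖L‖) := by gcongr
  have h10 := abs_le.1 ((abs_norm_sub_norm_le _ _).trans h5)
  rw [h6] at h10
  constructor
  · have h11 : (3 * ‖L‖ + 4 / ‖L‖)⁻¹ ≤ ‖L‖ / 4 := by
      rw [show ‖L‖ / 4 = (4 / ‖L‖)⁻¹ by rw [inv_div]]
      gcongr
      linarith
    have h12 : (3 * ‖L‖ + 4 / ‖L‖)⁻¹ * N ≤ ‖L‖ / 4 * N := by gcongr
    linarith [h10.1]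
  · have h11 : 0 ≤ 4 / ‖L‖ * N := by positivity
    have h12 : 0 ≤ ‖L‖ * N := by positivity
    linarith [h10.2]

/-! ### Powers of h and conclusion -/

/-- Since h^(-1/s) = h^(1-1/s)/h is o(1/h), half of b/h absorbs the growing exponential and the
other half the power. -/
lemma tendsto_exp_neg_div_mul_rpow_mul_exp {s : ℝ} (hs : 1 < s) {b : ℝ} (hb : 0 < b) (M a : ℝ) :
    Tendsto (fun h : ℝ => Real.exp (-(b / h)) * (h ^ (-a) * Real.exp (M * h ^ (-(1 / s)))))
      (𝓝[>] 0) (𝓝 0) := by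
  have hβ : 0 < 1 - 1 / s := by
    rw [sub_pos, div_lt_one (by linarith)]
    exact hs
  have h1 : Tendsto (fun h : ℝ => (h⁻¹) ^ a * Real.exp (-(b / 2) * h⁻¹)) (𝓝[>] 0) (𝓝 0) :=
    (tendsto_rpow_mul_exp_neg_mul_atTop_nhds_zero a (b / 2) (by positivity)).comp
      tendsto_inv_nhdsGT_zero
  have h2 : Tendsto (fun h : ℝ => M * h ^ (1 - 1 / s)) (𝓝[>] 0) (𝓝 0) := by
    have := ((Real.continuousAt_rpow_const 0 (1 - 1 / s) (Or.inr hβ.le)).tendsto.mono_left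
      (nhdsWithin_le_nhds (s := Ioi 0))).const_mul M
    rwa [Real.zero_rpow hβ.ne', mul_zero] at this
  refine squeeze_zero' ?_ ?_ h1
  · filter_upwards [self_mem_nhdsWithin] with h h0
    have : 0 < h := h0
    positivity
  · filter_upwards [self_mem_nhdsWithin, h2.eventually_le_const (half_pos hb)] with h h0 h3
    have hpos : 0 < h := h0
    have h4 : h ^ (-(1 / s)) = h ^ (1 - 1 / s) * h⁻¹ := by
      rw [← Real.rpow_neg_one h, ← Real.rpow_add hpos]
      ring_nf
    have h5 : M * h ^ (-(1 / s)) ≤ b / 2 * h⁻¹ := by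
      rw [h4, ← mul_assoc]
      gcongr
    rw [Real.inv_rpow hpos.le, ← Real.rpow_neg hpos.le, mul_left_comm, ← Real.exp_add]
    gcongr
    rw [div_eq_mul_inv]
    linarith

lemma neg_exp_two_mul_saddlePoint_re {s : ℝ} (hs : 1 < s) :
    (-Complex.exp (2 * saddlePoint (1 / (s - 1)))).re =
      -Real.cos (Real.pi * (1 - 1 / s)) * (2 * (s - 1)) ^ (-(2 * (1 - 1 / s))) := by
  have hs1 : s - 1 ≠ 0 := by linarith
  have hs0 : s ≠ 0 := by linarith
  have h1 : 1 / (s - 1) + 1 = s / (s - 1) := by field_simp; ring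
  have h2 : Real.log (1 / (s - 1) / 2) = -Real.log (2 * (s - 1)) := by
    rw [← Real.log_inv]
    congr 1
    field_simp
  rw [Complex.neg_re, Complex.exp_re, show (2 : ℂ) = ((2 : ℝ) : ℂ) by simp, Complex.re_ofReal_mul,
    Complex.im_ofReal_mul, saddlePoint_re, saddlePoint_im, h1, h2,
    Real.rpow_def_of_pos (by linarith)]
  have h3 : 2 * -(Real.pi / (2 * (s / (s - 1)))) = -(Real.pi * (1 - 1 / s)) := by
    field_simp
  have h4 : 2 * (-Real.log (2 * (s - 1)) / (s / (s - 1))) =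
      Real.log (2 * (s - 1)) * -(2 * (1 - 1 / s)) := by
    field_simp
  rw [h3, h4, Real.cos_neg]
  ring

theorem lemma1p9 (s : ℝ) (hs : 1 < s) :
    ∃ (c : ℝ) (d : ℂ), 0 < c ∧
      d.re = -Real.cos (Real.pi * (1 - 1 / s)) * (2 * (s - 1)) ^ (-(2 * (1 - 1 / s))) ∧
      (s < 2 → d.re < 0) ∧
      ∀ c₀ : ℝ, 0 < c₀ →
        ∃ h₀ K C : ℝ, 0 < h₀ ∧ 0 < K ∧ 0 < C ∧
          ∀ h : ℝ, 0 < h → h ≤ h₀ → ∀ x : EReal, (c₀ : EReal) ≤ x →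
            ∃ r q : ℂ, ‖r‖ ≤ K * h ^ (2 * (1 - 1 / s)) ∧ C⁻¹ ≤ ‖q‖ ∧ ‖q‖ ≤ C ∧
              oscIntegral (1 / (s - 1)) h x =
                q * ((h ^ (1 - 1 / (2 * s)) : ℝ) : ℂ) *
                  Complex.exp ((-(c : ℂ) + d * ((h ^ (1 - 1 / s) : ℝ) : ℂ) + r) /
                    ((h ^ (1 / s) : ℝ) : ℂ)) := by
  have hs0 : 0 < s := by linarith
  have hs1 : 0 < s - 1 := by linarith
  set θ := 1 / (s - 1) with hθdef
  have hθ : 0 < θ := by positivity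
  set β := 1 - 1 / s with hβdef
  have hβ : 0 < β := by
    rw [hβdef, sub_pos, div_lt_one hs0]
    exact hs
  have hd := neg_exp_two_mul_saddlePoint_re hs
  refine ⟨-(logPhase θ (saddlePoint θ)).re, -Complex.exp (2 * saddlePoint θ),
    neg_pos.2 (logPhase_saddlePoint_re_neg hθ), hd, fun h2 => ?_, fun c₀ hc₀ => ?_⟩
  · rw [hd]
    have hpi := Real.pi_pos
    have h3 : β < 1 / 2 := by
      have : 1 / 2 < 1 / s := by gcongr
      linarith
    have h4 : 0 < Real.cos (Real.pi * β) :=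
      Real.cos_pos_of_mem_Ioo ⟨by nlinarith, by nlinarith⟩
    rw [neg_mul]
    have : 0 < 2 * (s - 1) := by linarith
    exact neg_neg_of_pos (by positivity)
  obtain ⟨τ, hτ, hτO⟩ := exists_perturbed_saddlePoint hθ
  set ε : ℝ → ℝ := fun h => h ^ β with hεdef
  set μ : ℝ → ℝ := fun h => h ^ (-(1 / (2 * s))) with hμdef
  have hμ2 : ∀ h > 0, μ h ^ 2 = h ^ (-(1 / s)) := by
    intro h h0
    simp only [hμdef]
    rw [← Real.rpow_mul_natCast h0.le]
    congr 1
    push_cast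
    field_simp
  have hε : Tendsto ε (𝓝[>] 0) (𝓝 0) := by
    have := (Real.continuousAt_rpow_const 0 β (Or.inr hβ.le)).tendsto.mono_left
      (nhdsWithin_le_nhds (s := Ioi 0))
    rwa [Real.zero_rpow hβ.ne'] at this
  have hμ : Tendsto μ (𝓝[>] 0) atTop :=
    tendsto_rpow_neg_nhdsGT_zero (by rw [neg_lt_zero]; positivity)
  have hquot : ∀ h > 0, ε h / μ h = h ^ (1 - 1 / (2 * s)) := by
    intro h h0
    simp only [hεdef, hμdef]
    rw [← Real.rpow_sub h0]
    congr 1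
    rw [hβdef]
    field_simp
    ring
  have hτlim : Tendsto (fun h => τ (ε h)) (𝓝[>] 0) (𝓝 (saddlePoint θ)) := by
    have h1 : Tendsto (fun e => τ e - saddlePoint θ) (𝓝 0) (𝓝 0) := hτO.trans_tendsto tendsto_id
    exact tendsto_sub_nhds_zero_iff.1 (h1.comp hε)
  obtain ⟨C, hC, hbounds⟩ := eventually_oscIntegral_bounds hθ (ε := ε) (μ := μ)
    (τ := fun h => τ (ε h)) (fun h h0 => Real.rpow_pos_of_pos h0 _)
    (fun h h0 => Real.rpow_pos_of_pos h0 _) hε hμ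
    (fun h h0 => by
      rw [hμ2 h h0]
      simp only [hεdef]
      rw [← Real.rpow_sub h0, hβdef, sub_neg_eq_add, sub_add_cancel, Real.rpow_one])
    (fun h h0 => by
      rw [hμ2 h h0, mul_comm, ← Real.rpow_def_of_pos (Real.rpow_pos_of_pos h0 _)]
      rw [← Real.rpow_mul h0.le]
      congr 1
      rw [hβdef, hθdef]
      field_simp)
    (fun b hb M => by
      refine (tendsto_exp_neg_div_mul_rpow_mul_exp hs hb M (1 - 1 / (2 * s))).congr' ?_
      filter_upwards [self_mem_nhdsWithin] with h h0
      rw [hμ2 h h0, Real.rpow_neg (le_of_lt h0) (1 - 1 / (2 * s)), ← hquot h h0, inv_div])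
    (hε.eventually hτ) hτlim hc₀
  obtain ⟨K, hK, hKb⟩ := (isBigO_logPhase_sub hθ hτO).exists_pos
  obtain ⟨δ, hδ, hsub⟩ := mem_nhdsGT_iff_exists_Ioc_subset.1
    (hbounds.and (hε.eventually hKb.bound))
  refine ⟨δ, K, C, hδ, hK, hC, fun h h0 hδh x hx => ?_⟩
  obtain ⟨hI, hR⟩ := hsub ⟨h0, hδh⟩
  obtain ⟨hlow, hup⟩ := hI x hx
  set P := logPhase θ (τ (ε h)) - ε h * Complex.exp (2 * τ (ε h)) with hP
  set S := logPhase θ (saddlePoint θ) with hS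
  set R := P - (S - ε h * Complex.exp (2 * saddlePoint θ)) with hRdef
  set N := ((h ^ (1 - 1 / (2 * s)) : ℝ) : ℂ) *
    Complex.exp ((-((-S.re : ℝ) : ℂ) + -Complex.exp (2 * saddlePoint θ) * ((h ^ β : ℝ) : ℂ) + R) /
      ((h ^ (1 / s) : ℝ) : ℂ)) with hN
  have hpow : 0 < h ^ (1 - 1 / (2 * s)) := Real.rpow_pos_of_pos h0 _
  have hN0 : N ≠ 0 :=
    mul_ne_zero (by exact_mod_cast hpow.ne') (Complex.exp_ne_zero _)
  have hNnorm : ‖N‖ = ε h / μ h * ‖Complex.exp ((μ h : ℂ) ^ 2 * P)‖ := by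
    rw [hN, norm_mul, Complex.norm_real, Real.norm_of_nonneg hpow.le, hquot h h0,
      Complex.norm_exp, Complex.norm_exp]
    congr 2
    have h1 : (((h ^ (1 / s) : ℝ) : ℂ))⁻¹ = (((μ h) ^ 2 : ℝ) : ℂ) := by
      rw [hμ2 h h0, Real.rpow_neg h0.le, Complex.ofReal_inv]
    rw [div_eq_mul_inv, h1, mul_comm, ← Complex.ofReal_pow, Complex.re_ofReal_mul,
      Complex.re_ofReal_mul]
    congr 1
    -- The numerator is P - i Im S, so the discarded imaginary part does not change the modulus.
    have h2 : -((-S.re : ℝ) : ℂ) + -Complex.exp (2 * saddlePoint θ) * ((h ^ β : ℝ) : ℂ) + R =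
        P - S + (S.re : ℂ) := by
      simp only [hRdef, hεdef]
      push_cast
      ring
    rw [h2]
    simp
  rw [← hNnorm] at hlow hup
  -- Only |q| is constrained, so q is taken as the quotient and comparing moduli suffices.
  refine ⟨R, oscIntegral θ h x / N, ?_, ?_, ?_, ?_⟩
  · refine hR.trans_eq ?_
    rw [Real.norm_of_nonneg (sq_nonneg _)]
    simp only [hεdef]
    rw [← Real.rpow_mul_natCast h0.le]
    congr 2
    push_cast
    ring
  · rw [norm_div, le_div_iff₀ (norm_pos_iff.2 hN0)]
    exact hlow
  · rw [norm_div, div_le_iff₀ (norm_pos_iff.2 hN0)]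
    exact hup
  · rw [mul_assoc]
    exact (div_mul_cancel₀ _ hN0).symm
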